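/- For a nonempty integer partition $\pi$, let $s(\pi)$ denote its smallest part, and for $l\ge 1$ let $\delta_l=(l-1,l-2,\dots,1)$ be the triangular (staircase) partition whose parts are $1,2,\dots,l-1$, each occurring exactly once (so $\delta_1$ is empty). Let $\mathrm{spt}(n)$ be Andrews' smallest-parts function, the total number of occurrences of the smallest part, summed over all partitions of $n$. Let $\mathrm{spt}_o^{+}(n)$ be the total number of occurrences of the smallest part $s(\pi)$ in $\pi$, summed over all partitions $\pi$ of $n$ that contain no odd part greater than $2s(\pi)$. Let $\mathrm{spt}_o^{-}(n)$ be the total number of occurrences of $s(\pi)$ in $\pi$, summed over all partition pairs $\sigma=(\pi,\delta_{s(\pi)})$ of $n$, i.e. such that the sum of the parts of $\pi$ plus the sum $\binom{s(\pi)}{2}$ of the parts of $\delta_{s(\pi)}$ equals $n$, in which $\pi$ contains no odd part greater than $2s(\pi)$. Put $\mathrm{spt}_o(n)=\mathrm{spt}_o^{+}(n)-\mathrm{spt}_o^{-}(n)$. Then, for every integer $n\ge 0$, $$\mathrm{spt}_o(2n)=\mathrm{spt}(n)$$ (for $n=0$ all the counts are $0$). -/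

import Mathlib

namespace SptO

/-- The smallest part `s(π)` of a partition `π` (with the convention `0` for the empty partition,
which has no parts and so contributes nothing to any of the counts below). -/
def smallestPart {n : ℕ} (π : n.Partition) : ℕ :=
  π.parts.toFinset.min.untopD 0

/-- The number of times that the smallest part of `π` occurs in `π`. -/
def smallestCount {n : ℕ} (π : n.Partition) : ℕ :=
  π.parts.count (smallestPart π)

/-- No odd part of `π` is greater than `2 s(π)`. -/
def NoLargeOdd {n : ℕ} (π : n.Partition) : Prop :=
  ∀ i ∈ π.parts, Odd i → i ≤ 2 * smallestPart π

instance {n : ℕ} : DecidablePred (NoLargeOdd (n := n)) :=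
  fun π => inferInstanceAs (Decidable (∀ i ∈ π.parts, Odd i → i ≤ 2 * smallestPart π))

/-- `δ` is the triangular partition `δ_l`, with parts `1, 2, …, l - 1`, each occurring once. -/
def IsTriangular {n : ℕ} (l : ℕ) (δ : n.Partition) : Prop :=
  δ.parts = (Finset.Ico 1 l).val

instance {n : ℕ} (l : ℕ) : DecidablePred (IsTriangular (n := n) l) :=
  fun δ => inferInstanceAs (Decidable (δ.parts = (Finset.Ico 1 l).val))

/-- Andrews' function: the total number of smallest parts in all partitions of `n`. -/
def spt (n : ℕ) : ℕ :=
  ∑ π : n.Partition, smallestCount π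

/-- The total number of smallest parts in the partitions `π` of `n` in which no odd part is
greater than `2 s(π)`. -/
def sptOPlus (n : ℕ) : ℕ :=
  ∑ π : n.Partition with NoLargeOdd π, smallestCount π

/-- The total number of smallest parts of `π` in the pairs `(π, δ)` of partitions, of total size
`n`, such that no odd part of `π` is greater than `2 s(π)` and `δ = δ_{s(π)}`. -/
def sptOMinus (n : ℕ) : ℕ :=
  ∑ ab ∈ Finset.HasAntidiagonal.antidiagonal n,
    ∑ σ : ab.1.Partition × ab.2.Partition with
      NoLargeOdd σ.1 ∧ IsTriangular (smallestPart σ.1) σ.2, smallestCount σ.1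

/-- `spt_o(n) = spt_o⁺(n) - spt_o⁻(n)`, an integer. -/
def sptO (n : ℕ) : ℤ :=
  (sptOPlus n : ℤ) - (sptOMinus n : ℤ)

end SptO

/-!
Multiplied by `(q²; q²)_∞`, the generating function of `spt_o` becomes
`∑ qⁿ (q; q)_{n-1}² βₙ` with `βₙ = (1 - q^{C(n, 2)}) / ((q; q)_n (q; q²)_n)`, and that of `spt`,
with `q` replaced by `q²`, becomes `∑ q^{2n} (q²; q²)_{n-1}² βₙ'` with `βₙ' = 1 / (q²; q²)_n`.
Here `β` and `β'` belong to Bailey pairs in the bases `q` and `q²`, and the `α` of the first pair,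
which lives on the even integers `2r`, is the `α` of the second at `r`. The sequence conjugate to
`bⁿ (b; b)_{n-1}²` is `b^m / (1 - b^m)²`, which takes the same value at `b = q`, `m = 2r` as at
`b = q²`, `m = r`. Hence the Bailey transform turns both sums into
`∑ α_r q^{2r} / (1 - q^{2r})²`.

Infinite products are avoided by cutting all sums and products off at a finite level and bounding
the error in the `X`-adic valuation of Laurent series.
-/

namespace SptO

open Finset Function

section QFactorial

variable {R : Type*} [CommRing R]

/-- The `q`-factorial `(b; b)_n = (1 - b)(1 - b²)⋯(1 - bⁿ)` in base `b`. -/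
def qFactorial (b : R) (n : ℕ) : R :=
  ∏ i ∈ range n, (1 - b ^ (i + 1))

theorem qFactorial_succ (b : R) (n : ℕ) :
    qFactorial b (n + 1) = qFactorial b n * (1 - b ^ (n + 1)) :=
  prod_range_succ _ _

theorem qFactorial_mul_prod_Ioc (b : R) {m n : ℕ} (h : m ≤ n) :
    qFactorial b m * ∏ i ∈ Ioc m n, (1 - b ^ i) = qFactorial b n := by
  induction n, h using Nat.le_induction with
  | base => simp
  | succ n hn ih =>
    rw [← insert_Ioc_right_eq_Ioc_add_one hn, prod_insert (by simp), qFactorial_succ, ← ih]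
    ring

end QFactorial

variable {K : Type*} [Field K]

section BaileyKernel

variable {b : K}

theorem one_sub_zpow_ne_zero (hb : ¬IsOfFinOrder b) {m : ℤ} (hm : m ≠ 0) : 1 - b ^ m ≠ 0 :=
  sub_ne_zero.2 fun h => hb (isOfFinOrder_iff_zpow_eq_one.2 ⟨m, hm, h.symm⟩)

theorem one_sub_pow_succ_ne_zero (hb : ¬IsOfFinOrder b) (n : ℕ) : 1 - b ^ (n + 1) ≠ 0 := by
  exact_mod_cast one_sub_zpow_ne_zero hb (m := (n + 1 : ℕ)) (by omega)

theorem qFactorial_ne_zero (hb : ¬IsOfFinOrder b) (n : ℕ) : qFactorial b n ≠ 0 :=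
  prod_ne_zero_iff.2 fun i _ => one_sub_pow_succ_ne_zero hb i

/-- The reciprocal `1 / (b; b)_k` of the `q`-factorial at an integer `k`. It is zero for negative
`k`, which is the usual convention and makes `qRecip_sub_one` hold without exception. -/
noncomputable def qRecip (b : K) (k : ℤ) : K :=
  if k < 0 then 0 else (qFactorial b k.toNat)⁻¹

theorem qRecip_of_neg (b : K) {k : ℤ} (hk : k < 0) : qRecip b k = 0 := if_pos hk

theorem qRecip_natCast (b : K) (n : ℕ) : qRecip b n = (qFactorial b n)⁻¹ := by
  simp [qRecip]

theorem qRecip_sub_one (hb : ¬IsOfFinOrder b) (k : ℤ) :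
    qRecip b (k - 1) = (1 - b ^ k) * qRecip b k := by
  rcases lt_trichotomy k 0 with hk | rfl | hk
  · rw [qRecip_of_neg b hk, qRecip_of_neg b (by omega), mul_zero]
  · simp [qRecip_of_neg]
  · obtain ⟨n, rfl⟩ : ∃ n : ℕ, k = (n + 1 : ℕ) := ⟨(k - 1).toNat, by omega⟩
    have := one_sub_pow_succ_ne_zero hb n
    rw [Nat.cast_succ, add_sub_cancel_right, ← Nat.cast_succ, qRecip_natCast, qRecip_natCast,
      Nat.succ_eq_add_one, qFactorial_succ, zpow_natCast]
    field_simp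

/-- The kernel `1 / ((b; b)_{n-m} (b; b)_{n+m})` of the Bailey transform relative to `a = 1`. It
vanishes unless `|m| ≤ n`. -/
noncomputable def baileyKernel (b : K) (n : ℕ) (m : ℤ) : K :=
  qRecip b (n - m) * qRecip b (n + m)

theorem baileyKernel_neg (b : K) (n : ℕ) (m : ℤ) : baileyKernel b n (-m) = baileyKernel b n m := by
  rw [baileyKernel, baileyKernel, sub_neg_eq_add, ← sub_eq_add_neg, mul_comm]

theorem baileyKernel_eq_zero (b : K) {n : ℕ} {m : ℤ} (h : n < |m|) : baileyKernel b n m = 0 := by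
  rcases lt_abs.1 h with h | h
  · rw [baileyKernel, qRecip_of_neg b (by omega), zero_mul]
  · rw [baileyKernel, qRecip_of_neg b (k := n + m) (by omega), mul_zero]

theorem baileyKernel_natCast (b : K) {n m : ℕ} (h : m ≤ n) :
    baileyKernel b n m = (qFactorial b (n - m) * qFactorial b (n + m))⁻¹ := by
  rw [baileyKernel, ← Nat.cast_sub h, ← Nat.cast_add, qRecip_natCast, qRecip_natCast, mul_inv]

theorem baileyKernel_zero_zero (b : K) : baileyKernel b 0 0 = 1 := by
  simp [baileyKernel, qRecip, qFactorial]

theorem baileyKernel_eq_mul_baileyKernel_succ (hb0 : b ≠ 0) (hb : ¬IsOfFinOrder b) (n : ℕ)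
    (m : ℤ) :
    baileyKernel b n m =
      (1 - b ^ (n + 1) / b ^ m) * (1 - b ^ (n + 1) * b ^ m) * baileyKernel b (n + 1) m := by
  have hsub : (n - m : ℤ) = (n + 1 : ℕ) - m - 1 := by push_cast; ring
  have hadd : (n + m : ℤ) = (n + 1 : ℕ) + m - 1 := by push_cast; ring
  rw [baileyKernel, hsub, hadd, qRecip_sub_one hb, qRecip_sub_one hb, zpow_sub₀ hb0,
    zpow_add₀ hb0, zpow_natCast, baileyKernel]
  ring

theorem mul_baileyKernel_add_one (hb0 : b ≠ 0) (hb : ¬IsOfFinOrder b) (n : ℕ) (m : ℤ) :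
    (1 - b ^ n * b ^ (m + 1)) * baileyKernel b n (m + 1) =
      (1 - b ^ n / b ^ m) * baileyKernel b n m := by
  have hsub : (n - (m + 1) : ℤ) = n - m - 1 := by ring
  have hadd := qRecip_sub_one hb (n + (m + 1))
  rw [zpow_add₀ hb0, zpow_natCast, show (n + (m + 1) - 1 : ℤ) = n + m by ring] at hadd
  rw [baileyKernel, baileyKernel, hsub, hadd, qRecip_sub_one hb, zpow_sub₀ hb0, zpow_natCast]
  ring

theorem hasFiniteSupport_baileyKernel (b : K) (n : ℕ) {d : ℕ} (hd : d ≠ 0) :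
    HasFiniteSupport fun r : ℤ => baileyKernel b n (d * r) := by
  refine (Set.finite_Icc (-n : ℤ) n).subset fun r hr => Set.mem_Icc.2 (abs_le.1 ?_)
  by_contra! h
  refine hr (baileyKernel_eq_zero b (h.trans_le ?_))
  rw [abs_mul, Nat.abs_cast]
  exact le_mul_of_one_le_left (abs_nonneg r) (by omega)

/-- The sequence `γ` conjugate to `δ n = b^n (b; b)_{n-1}²` under the Bailey transform, with the
sum over `n` cut off after `n = N`. -/
noncomputable def baileyGamma (b : K) (N : ℕ) (m : ℤ) : K :=
  ∑ n ∈ range N, b ^ (n + 1) * qFactorial b n ^ 2 * baileyKernel b (n + 1) m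

theorem baileyGamma_neg (b : K) (N : ℕ) (m : ℤ) : baileyGamma b N (-m) = baileyGamma b N m := by
  simp only [baileyGamma, baileyKernel_neg]

theorem baileyGamma_eq (hb0 : b ≠ 0) (hb : ¬IsOfFinOrder b) {m : ℤ} (hm : m ≠ 0) (N : ℕ) :
    baileyGamma b N m = b ^ m / (1 - b ^ m) ^ 2 * (qFactorial b N ^ 2 * baileyKernel b N m) := by
  induction N with
  | zero => simp [baileyGamma, baileyKernel_eq_zero b (n := 0) (m := m) (by simpa using hm)]
  | succ N ih =>
    have hx : b ^ m ≠ 0 := zpow_ne_zero m hb0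
    have := one_sub_zpow_ne_zero hb hm
    rw [baileyGamma, sum_range_succ, ← baileyGamma, ih,
      baileyKernel_eq_mul_baileyKernel_succ hb0 hb, qFactorial_succ]
    field_simp
    ring

end BaileyKernel

section BaileyPair

variable {b : K} {d : ℕ} {α α' : ℤ → K} {β β' : ℕ → K}

theorem finsum_add_one_sub_eq_zero {A : Type*} [AddCommGroup A] {G : ℤ → A}
    (hG : G.HasFiniteSupport) : ∑ᶠ r, (G (r + 1) - G r) = 0 := by
  have hshift : HasFiniteSupport fun r => G (r + 1) := hG.comp_of_injective (add_left_injective 1)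
  rw [finsum_sub_distrib hshift hG, sub_eq_zero]
  exact finsum_comp_equiv (Equiv.addRight 1)

/-- `(α, β)` is a bilateral Bailey pair in base `b` relative to `a = 1`, in which the sequence `α`
sits at the multiples of `d`. Summing over all integers instead of `r ≥ 0` removes the boundary
terms from telescoping sums. -/
def IsBaileyPair (b : K) (d : ℕ) (α : ℤ → K) (β : ℕ → K) : Prop :=
  ∀ n, ∑ᶠ r : ℤ, α r * baileyKernel b n (d * r) = β n

theorem hasFiniteSupport_mul_baileyKernel (b : K) (n : ℕ) (hd : d ≠ 0) (α : ℤ → K) :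
    HasFiniteSupport fun r : ℤ => α r * baileyKernel b n (d * r) :=
  (hasFiniteSupport_baileyKernel b n hd).mul_right α

theorem IsBaileyPair.sub (hd : d ≠ 0) (h : IsBaileyPair b d α β) (h' : IsBaileyPair b d α' β') :
    IsBaileyPair b d (α - α') (β - β') := fun n => by
  simp only [Pi.sub_apply, sub_mul, ← h n, ← h' n]
  exact finsum_sub_distrib (hasFiniteSupport_mul_baileyKernel b n hd α)
    (hasFiniteSupport_mul_baileyKernel b n hd α')

/-- Creative telescoping: the recurrence `u n * β (n + 1) = w n * β n` with certificate `g n`. -/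
theorem IsBaileyPair.of_telescope (hd : d ≠ 0) (h0 : α 0 = β 0) {u w : ℕ → K}
    (hu : ∀ n, u n ≠ 0) (hβ : ∀ n, u n * β (n + 1) = w n * β n) {g : ℕ → ℤ → K}
    (h : ∀ n r, u n * (α r * baileyKernel b (n + 1) (d * r)) -
      w n * (α r * baileyKernel b n (d * r)) =
        g n (r + 1) * baileyKernel b (n + 1) (d * (r + 1)) -
          g n r * baileyKernel b (n + 1) (d * r)) :
    IsBaileyPair b d α β := fun n => by
  induction n with
  | zero =>
    rw [finsum_eq_single _ 0 fun r hr => ?_, mul_zero, baileyKernel_zero_zero, mul_one, h0]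
    rw [baileyKernel_eq_zero b (by simp [Nat.pos_of_ne_zero hd, hr]), mul_zero]
  | succ n ih =>
    have hfin := fun n => hasFiniteSupport_mul_baileyKernel b n hd α
    have hsum := finsum_add_one_sub_eq_zero
      (hasFiniteSupport_mul_baileyKernel b (n + 1) hd (g n))
    simp only [← h] at hsum
    rw [finsum_sub_distrib ((hfin (n + 1)).fun_mul_right fun _ => u n)
      ((hfin n).fun_mul_right fun _ => w n), ← mul_finsum, ← mul_finsum, ih, ← hβ,
      ← mul_sub] at hsum
    exact sub_eq_zero.1 ((mul_eq_zero.1 hsum).resolve_left (hu n))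

theorem hasFiniteSupport_mul_baileyGamma (b : K) (N : ℕ) (hd : d ≠ 0) (α : ℤ → K) :
    HasFiniteSupport fun r : ℤ => α r * baileyGamma b N (d * r) := by
  have := fun n => hasFiniteSupport_baileyKernel b n hd
  unfold baileyGamma
  fun_prop

theorem IsBaileyPair.sum_qFactorial_sq_mul (hd : d ≠ 0) (h : IsBaileyPair b d α β) (N : ℕ) :
    ∑ n ∈ range N, b ^ (n + 1) * qFactorial b n ^ 2 * β (n + 1) =
      ∑ᶠ r : ℤ, α r * baileyGamma b N (d * r) := by
  simp only [← h _, baileyGamma, mul_finsum, mul_sum]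
  rw [sum_finsum_comm _ _ fun n _ =>
    (hasFiniteSupport_mul_baileyKernel b (n + 1) hd α).fun_mul_right _]
  exact finsum_congr fun r => sum_congr rfl fun n _ => mul_left_comm _ _ _

end BaileyPair

section SlaterPairs

variable {q : K}

/-- The alternating coefficients `(-1)^r q^{r(3r-1)}` of Euler's pentagonal number theorem in base
`q²`. -/
noncomputable def pentCoeff (q : K) (r : ℤ) : K :=
  (-1) ^ r * q ^ (r * (3 * r - 1))

/-- The alternating coefficients `(-1)^r q^{r(r-1)}`, whose exponents are twice the triangular
numbers. -/
noncomputable def triCoeff (q : K) (r : ℤ) : K :=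
  (-1) ^ r * q ^ (r * (r - 1))

theorem pentCoeff_add_one (hq0 : q ≠ 0) (r : ℤ) :
    pentCoeff q (r + 1) = -(q ^ 2 * (q ^ r) ^ 6) * pentCoeff q r := by
  have : (r + 1) * (3 * (r + 1) - 1) = r * (3 * r - 1) + r * 6 + 2 := by ring
  rw [pentCoeff, pentCoeff, this, zpow_add₀ hq0, zpow_add₀ hq0, zpow_add₀ (by simp),
    zpow_mul q r 6, zpow_one, zpow_ofNat, zpow_ofNat]
  ring

theorem triCoeff_add_one (hq0 : q ≠ 0) (r : ℤ) :
    triCoeff q (r + 1) = -(q ^ r) ^ 2 * triCoeff q r := by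
  have : (r + 1) * (r + 1 - 1) = r * (r - 1) + r * 2 := by ring
  rw [triCoeff, triCoeff, this, zpow_add₀ hq0, zpow_add₀ (by simp), zpow_mul q r 2, zpow_one,
    zpow_ofNat]
  ring

theorem sq_zpow (q : K) (r : ℤ) : (q ^ 2) ^ r = (q ^ r) ^ 2 := by
  rw [← zpow_natCast, ← zpow_mul, ← zpow_natCast, ← zpow_mul, mul_comm]

theorem zpow_two_mul (q : K) (r : ℤ) : q ^ (2 * r) = (q ^ r) ^ 2 := by
  rw [zpow_mul, zpow_ofNat, sq_zpow]

theorem not_isOfFinOrder_sq (hq : ¬IsOfFinOrder q) : ¬IsOfFinOrder (q ^ 2) :=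
  fun h => hq (h.of_pow two_ne_zero)

/-- Slater's sequence `1 / ((q; q)_n (q; q²)_n)`, in which `(q; q²)_n` is written as
`(q; q)_{2n} / (q²; q²)_n`. -/
noncomputable def slaterBeta (q : K) (n : ℕ) : K :=
  qFactorial (q ^ 2) n / (qFactorial q n * qFactorial q (2 * n))

theorem slaterBeta_succ (hq : ¬IsOfFinOrder q) (n : ℕ) :
    (1 - q ^ (n + 1)) * (1 - q ^ (2 * n + 1)) * slaterBeta q (n + 1) = slaterBeta q n := by
  have := one_sub_pow_succ_ne_zero hq n
  have := one_sub_pow_succ_ne_zero hq (2 * n)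
  have := one_sub_pow_succ_ne_zero hq (2 * n + 1)
  have := qFactorial_ne_zero hq n
  have := qFactorial_ne_zero hq (2 * n)
  rw [slaterBeta, slaterBeta, show 2 * (n + 1) = 2 * n + 1 + 1 by ring]
  simp only [qFactorial_succ]
  rw [← pow_mul, show 2 * (n + 1) = 2 * n + 1 + 1 by ring]
  field_simp

theorem mul_baileyKernel_add_two (hq0 : q ≠ 0) (hq : ¬IsOfFinOrder q) (n : ℕ) (m : ℤ) :
    (1 - q ^ n * q ^ (m + 2)) * (1 - q ^ n * q ^ (m + 1)) * baileyKernel q n (m + 2) =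
      (1 - q ^ n / q ^ (m + 1)) * (1 - q ^ n / q ^ m) * baileyKernel q n m := by
  have h := mul_baileyKernel_add_one hq0 hq n (m + 1)
  rw [add_assoc, one_add_one_eq_two] at h
  rw [mul_assoc, mul_left_comm, h, mul_left_comm, mul_baileyKernel_add_one hq0 hq]
  ring

/-- The factor `1 + q ^ (2 r)` symmetrizes the sum over `r` under `r ↦ -r`. This doubles the sum and
brings the recurrence produced by creative telescoping down to order one (Paule's creative
symmetrizing). -/
theorem isBaileyPair_pentCoeff_sq (hq0 : q ≠ 0) (hq : ¬IsOfFinOrder q) :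
    IsBaileyPair (q ^ 2) 1 (fun r => pentCoeff q r * (1 + q ^ (2 * r)))
      (fun n => 2 / qFactorial (q ^ 2) n) := by
  have hb := not_isOfFinOrder_sq hq
  have hb0 := pow_ne_zero 2 hq0
  refine .of_telescope one_ne_zero ?_ (u := fun n => 1 - (q ^ 2) ^ (n + 1)) (w := 1)
    (g := fun n r => -(q ^ (2 * n + 2) / q ^ (2 * r) * pentCoeff q r *
      (1 - (q ^ 2) ^ (n + 1) * (q ^ 2) ^ r)))
    (one_sub_pow_succ_ne_zero hb) (fun n => ?_) fun n r => ?_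
  · norm_num [pentCoeff, qFactorial]
  · have := one_sub_pow_succ_ne_zero hb n
    rw [qFactorial_succ, Pi.one_apply]
    field_simp
  · have hx : q ^ r ≠ 0 := zpow_ne_zero r hq0
    have hshift := mul_baileyKernel_add_one hb0 hb (n + 1) r
    simp only [Nat.cast_one, one_mul, Pi.one_apply, pentCoeff_add_one hq0, zpow_two_mul,
      zpow_add_one₀ hq0, sq_zpow, baileyKernel_eq_mul_baileyKernel_succ hb0 hb n] at hshift ⊢
    linear_combination (norm := (field_simp; ring))
      -(q ^ (2 * n + 2) * (q ^ r) ^ 4 * pentCoeff q r) * hshift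

theorem isBaileyPair_triCoeff_sq (hq0 : q ≠ 0) (hq : ¬IsOfFinOrder q) :
    IsBaileyPair (q ^ 2) 1 (fun r => triCoeff q r * (1 + q ^ (2 * r)))
      (fun n => if n = 0 then 2 else 0) := by
  have hb := not_isOfFinOrder_sq hq
  have hb0 := pow_ne_zero 2 hq0
  refine .of_telescope one_ne_zero ?_ (u := fun n => 1 - (q ^ 2) ^ (n + 1)) (w := 0)
    (g := fun n r => -(triCoeff q r * (1 - (q ^ 2) ^ (n + 1) * (q ^ 2) ^ r)))
    (one_sub_pow_succ_ne_zero hb) (fun n => by simp) fun n r => ?_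
  · norm_num [triCoeff]
  · have hx : q ^ r ≠ 0 := zpow_ne_zero r hq0
    have hshift := mul_baileyKernel_add_one hb0 hb (n + 1) r
    simp only [Nat.cast_one, one_mul, Pi.zero_apply, triCoeff_add_one hq0, zpow_two_mul,
      zpow_add_one₀ hq0, sq_zpow] at hshift ⊢
    linear_combination (norm := (field_simp; ring)) -((q ^ r) ^ 2 * triCoeff q r) * hshift

theorem isBaileyPair_pentCoeff (hq0 : q ≠ 0) (hq : ¬IsOfFinOrder q) :
    IsBaileyPair q 2 (fun r => pentCoeff q r * (1 + q ^ (2 * r)))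
      (fun n => 2 * slaterBeta q n) := by
  refine .of_telescope two_ne_zero ?_
    (u := fun n => (1 - q ^ (n + 1)) * (1 - q ^ (2 * n + 1))) (w := 1)
    (g := fun n r => -(q ^ (n + 1) / q ^ (2 * r) * pentCoeff q r *
      ((1 - q ^ (n + 1) * q ^ (2 * r)) * (1 - q ^ (n + 1) * q ^ (2 * r - 1)))))
    (fun n => mul_ne_zero (one_sub_pow_succ_ne_zero hq n) (one_sub_pow_succ_ne_zero hq (2 * n)))
    (fun n => ?_) fun n r => ?_
  · norm_num [pentCoeff, slaterBeta, qFactorial]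
  · rw [mul_left_comm, slaterBeta_succ hq, Pi.one_apply, one_mul]
  · have hx : q ^ r ≠ 0 := zpow_ne_zero r hq0
    have hshift := mul_baileyKernel_add_two hq0 hq (n + 1) (2 * r)
    rw [show 2 * r + 2 = 2 * (r + 1) by ring] at hshift
    simp only [Nat.cast_ofNat, one_mul, Pi.one_apply, pentCoeff_add_one hq0, zpow_two_mul,
      zpow_add_one₀ hq0, zpow_sub_one₀ hq0, baileyKernel_eq_mul_baileyKernel_succ hq0 hq n]
      at hshift ⊢
    linear_combination (norm := (field_simp; ring))
      -(q ^ (n + 1) * (q ^ r) ^ 4 * pentCoeff q r) * hshift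

theorem isBaileyPair_triCoeff (hq0 : q ≠ 0) (hq : ¬IsOfFinOrder q) :
    IsBaileyPair q 2 (fun r => triCoeff q r * (1 + q ^ (2 * r)))
      (fun n => 2 * (q ^ n.choose 2 * slaterBeta q n)) := by
  refine .of_telescope two_ne_zero ?_
    (u := fun n => (1 - q ^ (n + 1)) * (1 - q ^ (2 * n + 1))) (w := fun n => q ^ n)
    (g := fun n r => -(triCoeff q r *
      ((1 - q ^ (n + 1) * q ^ (2 * r)) * (1 - q ^ (n + 1) * q ^ (2 * r - 1)))))
    (fun n => mul_ne_zero (one_sub_pow_succ_ne_zero hq n) (one_sub_pow_succ_ne_zero hq (2 * n)))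
    (fun n => ?_) fun n r => ?_
  · norm_num [triCoeff, slaterBeta, qFactorial]
  · rw [← slaterBeta_succ hq n, Nat.choose_succ_succ' n 1, Nat.choose_one_right, pow_add]
    ring
  · have hx : q ^ r ≠ 0 := zpow_ne_zero r hq0
    have hshift := mul_baileyKernel_add_two hq0 hq (n + 1) (2 * r)
    rw [show 2 * r + 2 = 2 * (r + 1) by ring] at hshift
    simp only [Nat.cast_ofNat, triCoeff_add_one hq0, zpow_two_mul, zpow_add_one₀ hq0,
      zpow_sub_one₀ hq0, baileyKernel_eq_mul_baileyKernel_succ hq0 hq n] at hshift ⊢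
    linear_combination (norm := (field_simp; ring)) -((q ^ r) ^ 2 * triCoeff q r) * hshift

/-- The common sequence `α` of the two Bailey pairs whose `β` encode `spt_o` and `spt`. -/
noncomputable def sptAlpha (q : K) (r : ℤ) : K :=
  (pentCoeff q r - triCoeff q r) * (1 + q ^ (2 * r))

theorem isBaileyPair_sptAlpha (hq0 : q ≠ 0) (hq : ¬IsOfFinOrder q) :
    IsBaileyPair q 2 (sptAlpha q) fun n => 2 * ((1 - q ^ n.choose 2) * slaterBeta q n) := by
  convert (isBaileyPair_pentCoeff hq0 hq).sub two_ne_zero (isBaileyPair_triCoeff hq0 hq) using 1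
  · exact funext fun r => sub_mul _ _ _
  · exact funext fun n => by rw [Pi.sub_apply]; ring

theorem isBaileyPair_sptAlpha_sq (hq0 : q ≠ 0) (hq : ¬IsOfFinOrder q) :
    IsBaileyPair (q ^ 2) 1 (sptAlpha q)
      fun n => if n = 0 then 0 else 2 / qFactorial (q ^ 2) n := by
  convert (isBaileyPair_pentCoeff_sq hq0 hq).sub one_ne_zero (isBaileyPair_triCoeff_sq hq0 hq)
    using 1
  · exact funext fun r => sub_mul _ _ _
  · refine funext fun n => ?_
    rcases eq_or_ne n 0 with rfl | hn <;> simp [qFactorial, *]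

theorem sptAlpha_zero (q : K) : sptAlpha q 0 = 0 := by
  simp [sptAlpha, pentCoeff, triCoeff]

end SlaterPairs

section Valuation

variable {Γ₀ : Type*} [LinearOrderedCommGroupWithZero Γ₀] {v : Valuation K Γ₀} {b q : K}

theorem not_isOfFinOrder_of_valuation_lt_one (hb : v b < 1) : ¬IsOfFinOrder b := fun h => by
  obtain ⟨n, hn, h⟩ := isOfFinOrder_iff_pow_eq_one.1 h
  have := pow_lt_one₀ zero_le hb hn.ne'
  rw [← map_pow, h, map_one] at this
  exact this.false

theorem valuation_one_sub_pow (hb : v b < 1) {n : ℕ} (hn : n ≠ 0) : v (1 - b ^ n) = 1 :=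
  v.map_one_sub_of_lt (by rw [map_pow]; exact pow_lt_one₀ zero_le hb hn)

theorem valuation_qFactorial (hb : v b < 1) (n : ℕ) : v (qFactorial b n) = 1 := by
  rw [qFactorial, map_prod]
  exact prod_eq_one fun i _ => valuation_one_sub_pow hb i.succ_ne_zero

theorem valuation_qFactorial_sub_le (hb : v b < 1) {m n : ℕ} (h : m ≤ n) :
    v (qFactorial b n - qFactorial b m) ≤ v b ^ (m + 1) := by
  induction n, h using Nat.le_induction with
  | base => simp
  | succ n hmn ih =>
    rw [qFactorial_succ, mul_sub, mul_one, sub_right_comm]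
    refine v.map_sub_le ih ?_
    rw [map_mul, valuation_qFactorial hb, one_mul, map_pow]
    exact pow_le_pow_right_of_le_one' hb.le (by omega)

theorem valuation_sq_mul_baileyKernel_sub_one_le (hb : v b < 1) {N m : ℕ} (h : m ≤ N) :
    v (qFactorial b N ^ 2 * baileyKernel b N m - 1) ≤ v b ^ (N - m + 1) := by
  have hne := qFactorial_ne_zero (not_isOfFinOrder_of_valuation_lt_one hb)
  have hsplit : qFactorial b N ^ 2 * baileyKernel b N m - 1 =
      (qFactorial b N * (qFactorial b N - qFactorial b (N - m)) -
        qFactorial b (N - m) * (qFactorial b (N + m) - qFactorial b N)) /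
      (qFactorial b (N - m) * qFactorial b (N + m)) := by
    have := hne (N - m)
    have := hne (N + m)
    rw [baileyKernel_natCast b h]
    field_simp
    ring
  rw [hsplit, map_div₀, map_mul, valuation_qFactorial hb, valuation_qFactorial hb, mul_one, div_one]
  refine v.map_sub_le ?_ ?_
  · rw [map_mul, valuation_qFactorial hb, one_mul]
    exact valuation_qFactorial_sub_le hb (by omega)
  · rw [map_mul, valuation_qFactorial hb, one_mul]
    exact (valuation_qFactorial_sub_le hb (by omega)).trans
      (pow_le_pow_right_of_le_one' hb.le (by omega))

theorem div_one_sub_sq_inv (x : K) : x⁻¹ / (1 - x⁻¹) ^ 2 = x / (1 - x) ^ 2 := by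
  rcases eq_or_ne x 0 with rfl | hx
  · simp
  · rw [show 1 - x⁻¹ = -(1 - x) / x by field_simp; ring, div_pow, neg_sq]
    field_simp

/-- The truncation error of `γ` is uniform in `m`: the precision lost in `(b; b)_{N-m}` is
compensated by the factor `b^m`. -/
theorem valuation_baileyGamma_sub_le (hb0 : b ≠ 0) (hb : v b < 1) (N : ℕ) {m : ℤ} (hm : m ≠ 0) :
    v (baileyGamma b N m - b ^ m / (1 - b ^ m) ^ 2) ≤ v b ^ (N + 1) := by
  wlog hpos : 0 < m generalizing m
  · have := this (neg_ne_zero.2 hm) (by omega)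
    rwa [baileyGamma_neg, zpow_neg, div_one_sub_sq_inv] at this
  lift m to ℕ using hpos.le
  rw [Nat.cast_ne_zero] at hm
  have hne := not_isOfFinOrder_of_valuation_lt_one hb
  rw [baileyGamma_eq hb0 hne (by exact_mod_cast hm), ← mul_sub_one, zpow_natCast, map_mul,
    map_div₀, map_pow, map_pow, valuation_one_sub_pow hb hm, one_pow, div_one]
  rcases le_or_gt m N with h | h
  · calc v b ^ m * v (qFactorial b N ^ 2 * baileyKernel b N m - 1)
        ≤ v b ^ m * v b ^ (N - m + 1) := by
          gcongr
          exact valuation_sq_mul_baileyKernel_sub_one_le hb h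
      _ = v b ^ (N + 1) := by
          rw [← pow_add]
          congr 1
          omega
  · rw [baileyKernel_eq_zero b (by simpa using h), mul_zero, zero_sub, v.map_neg, map_one, mul_one]
    exact pow_le_pow_right_of_le_one' hb.le h

/-- Both sides of the Bailey transform tend to `∑ α r q^{dr} / (1 - q^{dr})²`, which only depends
on `α` and `q^d`. -/
theorem IsBaileyPair.valuation_sum_sub_sum_le {d : ℕ} {α : ℤ → K} {β β' : ℕ → K} (hd : d ≠ 0)
    (hq0 : q ≠ 0) (hq : v q < 1) (h : IsBaileyPair q d α β) (h' : IsBaileyPair (q ^ d) 1 α β')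
    (hα0 : α 0 = 0) (hα : ∀ r, v (α r) ≤ 1) (N : ℕ) :
    v (∑ n ∈ range N, q ^ (n + 1) * qFactorial q n ^ 2 * β (n + 1) -
      ∑ n ∈ range N, (q ^ d) ^ (n + 1) * qFactorial (q ^ d) n ^ 2 * β' (n + 1)) ≤
        v q ^ (N + 1) := by
  have hqd : v (q ^ d) < 1 := by
    rw [map_pow]
    exact pow_lt_one₀ zero_le hq hd
  rw [h.sum_qFactorial_sq_mul hd, h'.sum_qFactorial_sq_mul one_ne_zero,
    ← finsum_sub_distrib (hasFiniteSupport_mul_baileyGamma q N hd α)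
      (hasFiniteSupport_mul_baileyGamma (q ^ d) N one_ne_zero α)]
  refine finsum_induction (fun x => v x ≤ v q ^ (N + 1)) (by simp) (fun _ _ => v.map_add_le)
    fun r => ?_
  rcases eq_or_ne r 0 with rfl | hr
  · simp [hα0]
  have hlim := valuation_baileyGamma_sub_le hq0 hq N (m := d * r) (by simp [hd, hr])
  have hlim' := valuation_baileyGamma_sub_le (pow_ne_zero d hq0) hqd N hr
  rw [← zpow_natCast q d, ← zpow_mul, zpow_natCast q d, map_pow, ← pow_mul] at hlim'
  rw [Nat.cast_one, one_mul, ← mul_sub, map_mul, ← sub_sub_sub_cancel_right]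
  refine (mul_le_of_le_one_left' (hα r)).trans (v.map_sub_le hlim (hlim'.trans ?_))
  exact pow_le_pow_right_of_le_one' hq.le (Nat.le_mul_of_pos_left _ (Nat.pos_of_ne_zero hd))

theorem valuation_sptAlpha_le_one (hq0 : q ≠ 0) (hq : v q < 1) (r : ℤ) : v (sptAlpha q r) ≤ 1 := by
  have hpow : ∀ k : ℤ, 0 ≤ k → v (q ^ k) ≤ 1 := fun k hk => by
    lift k to ℕ using hk
    rw [zpow_natCast, map_pow]
    exact pow_le_one₀ zero_le hq.le
  have hsplit : sptAlpha q r = (-1) ^ r * (q ^ (r * (3 * r - 1)) + q ^ (r * (3 * r + 1)) -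
      (q ^ (r * (r - 1)) + q ^ (r * (r + 1)))) := by
    rw [show r * (3 * r + 1) = r * (3 * r - 1) + 2 * r by ring,
      show r * (r + 1) = r * (r - 1) + 2 * r by ring, zpow_add₀ hq0, zpow_add₀ hq0, sptAlpha,
      pentCoeff, triCoeff]
    ring
  have hsub : 0 ≤ r * (r - 1) := by rcases le_or_gt r 0 with h | h <;> nlinarith
  have hadd : 0 ≤ r * (r + 1) := by rcases lt_or_ge r 0 with h | h <;> nlinarith
  rw [hsplit, map_mul, map_zpow₀, v.map_neg, map_one, one_zpow, one_mul]
  exact v.map_sub_le (v.map_add_le (hpow _ (by nlinarith)) (hpow _ (by nlinarith)))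
    (v.map_add_le (hpow _ hsub) (hpow _ hadd))

end Valuation

section GeneratingFunctions

open PowerSeries
open scoped PowerSeries.WithPiTopology

variable {R : Type*}

theorem genFun_eq_prod [CommSemiring R] [TopologicalSpace R] [T2Space R] (f : ℕ → ℕ → R)
    {V : Finset ℕ} (hV : 0 ∉ V) (hf : ∀ i ∉ V, ∀ c, f i c = 0) :
    Nat.Partition.genFun f = ∏ i ∈ V, (1 + ∑' j, f i (j + 1) • (X : R⟦X⟧) ^ (i * (j + 1))) := by
  have hV' : V = (V.preimage (· + 1) (add_left_injective 1).injOn).map (addRightEmbedding 1) := by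
    ext i
    cases i <;> simp [hV]
  rw [Nat.Partition.genFun_eq_tprod, hV', prod_map]
  refine tprod_eq_prod fun i hi => ?_
  simp only [mem_preimage] at hi
  simp [hf _ hi]

theorem one_add_tsum_mul_one_sub [CommRing R] [TopologicalSpace R] [IsTopologicalRing R]
    [T2Space R] {i : ℕ} (hi : i ≠ 0) :
    (1 + ∑' j, (1 : R) • (X : R⟦X⟧) ^ (i * (j + 1))) * (1 - X ^ i) = 1 := by
  have hX : ((X : R⟦X⟧) ^ i).constantCoeff = 0 := by simp [hi]
  have hgeom := WithPiTopology.tsum_pow_mul_one_sub_of_constantCoeff_eq_zero hX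
  rw [(WithPiTopology.summable_pow_of_constantCoeff_eq_zero hX).tsum_eq_zero_add, pow_zero]
    at hgeom
  simpa only [one_smul, pow_mul] using hgeom

theorem tsum_smul_mul_one_sub_sq [CommRing R] [TopologicalSpace R] [IsTopologicalRing R]
    [T2Space R] {i : ℕ} (hi : i ≠ 0) :
    (∑' j, ((j + 1 : ℕ) : R) • (X : R⟦X⟧) ^ (i * (j + 1))) * (1 - X ^ i) ^ 2 = X ^ i := by
  have hcount := Nat.Partition.summable_genFun_term' (fun _ c => (c : R)) hi
  have hone := Nat.Partition.summable_genFun_term' (fun _ _ => (1 : R)) hi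
  have hshift : ∑' j, ((j + 1 + 1 : ℕ) : R) • (X : R⟦X⟧) ^ (i * (j + 1 + 1)) =
      X ^ i * ∑' j, ((j + 1 : ℕ) : R) • (X : R⟦X⟧) ^ (i * (j + 1)) +
        X ^ i * ∑' j, (1 : R) • (X : R⟦X⟧) ^ (i * (j + 1)) := by
    rw [← hcount.tsum_mul_left, ← hone.tsum_mul_left,
      ← (hcount.mul_left _).tsum_add (hone.mul_left _)]
    refine tsum_congr fun j => ?_
    rw [Nat.cast_succ, add_smul, mul_add_one i (j + 1), pow_add, mul_smul_comm, mul_smul_comm,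
      mul_comm (X ^ i)]
  have hsplit := hcount.tsum_eq_zero_add
  rw [hshift, zero_add, mul_one, Nat.cast_one, one_smul] at hsplit
  linear_combination (1 - X ^ i) * hsplit + X ^ i * one_add_tsum_mul_one_sub (R := R) hi

/-- The generating function of the partitions with all parts in `insert s U`, each counted with
the number of occurrences of the part `s`. -/
noncomputable def countGenFun (R : Type*) [CommRing R] (s : ℕ) (U : Finset ℕ) : R⟦X⟧ :=
  mk fun n => ∑ π : n.Partition with ∀ i ∈ π.parts, i ∈ insert s U, (π.parts.count s : R)

/-- The weight of `c` occurrences of the part `i`: the part `s` has the weight `t c`, the parts in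
`U` have weight one, and no other parts are allowed. -/
def partWeight [CommSemiring R] (s : ℕ) (U : Finset ℕ) (t : ℕ → R) (i c : ℕ) : R :=
  (if i = s then t c else 1) * if i ∈ insert s U then 1 else 0

theorem coeff_genFun_partWeight [CommSemiring R] (s : ℕ) (U : Finset ℕ) (t : ℕ → R) (n : ℕ) :
    coeff n (Nat.Partition.genFun (partWeight s U t)) =
      ∑ π : n.Partition with ∀ i ∈ π.parts, i ∈ insert s U,
        if s ∈ π.parts then t (π.parts.count s) else 1 := by
  rw [Nat.Partition.coeff_genFun, sum_filter]
  refine sum_congr rfl fun π _ => ?_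
  simp only [Finsupp.prod, partWeight, prod_ite_eq', prod_ite_zero, Multiset.toFinsupp_support,
    Multiset.toFinsupp_apply, Multiset.mem_toFinset, mul_ite, mul_one, mul_zero]

theorem countGenFun_eq_sub [CommRing R] (s : ℕ) (U : Finset ℕ) :
    countGenFun R s U = Nat.Partition.genFun (partWeight s U fun c => (c : R)) -
      Nat.Partition.genFun (partWeight s U fun _ => 0) := by
  ext n
  rw [map_sub, coeff_genFun_partWeight, coeff_genFun_partWeight, ← sum_sub_distrib, countGenFun,
    coeff_mk]
  refine sum_congr rfl fun π _ => ?_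
  split_ifs with hs
  · rw [sub_zero]
  · rw [Multiset.count_eq_zero_of_notMem hs, Nat.cast_zero, sub_self]

theorem genFun_partWeight_mul_prod [CommRing R] [TopologicalSpace R] [IsTopologicalRing R]
    [T2Space R] {s : ℕ} (hs : s ≠ 0) {U : Finset ℕ} (hU : 0 ∉ U) (hsU : s ∉ U) (t : ℕ → R) :
    Nat.Partition.genFun (partWeight s U t) * ∏ i ∈ U, (1 - X ^ i) =
      1 + ∑' j, t (j + 1) • (X : R⟦X⟧) ^ (s * (j + 1)) := by
  rw [genFun_eq_prod (V := insert s U) _ (by simp [hU, hs.symm])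
    fun i hi c => by rw [partWeight, if_neg hi, mul_zero], prod_insert hsU, mul_assoc,
    ← prod_mul_distrib, prod_eq_one fun i hi => ?_]
  · simp [partWeight]
  · have his : i ≠ s := ne_of_mem_of_not_mem hi hsU
    have hi0 : i ≠ 0 := ne_of_mem_of_not_mem hi hU
    simpa [partWeight, his, hi] using one_add_tsum_mul_one_sub (R := R) hi0

theorem countGenFun_mul [CommRing R] {s : ℕ} (hs : s ≠ 0) {U : Finset ℕ} (hU : 0 ∉ U)
    (hsU : s ∉ U) :
    countGenFun R s U * ((1 - X ^ s) ^ 2 * ∏ i ∈ U, (1 - X ^ i)) = X ^ s := by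
  let : TopologicalSpace R := ⊥
  have : DiscreteTopology R := ⟨rfl⟩
  have hcount := genFun_partWeight_mul_prod hs hU hsU fun c => (c : R)
  have hzero := genFun_partWeight_mul_prod hs hU hsU fun _ => (0 : R)
  simp only [zero_smul, tsum_zero] at hzero
  rw [countGenFun_eq_sub]
  linear_combination (1 - X ^ s) ^ 2 * (hcount - hzero) + tsum_smul_mul_one_sub_sq (R := R) hs

end GeneratingFunctions

section SmallestPart

open PowerSeries

variable {n : ℕ}

theorem smallestPart_mem {π : n.Partition} (h : π.parts ≠ 0) : smallestPart π ∈ π.parts := by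
  have hne : π.parts.toFinset.Nonempty := by simpa using h
  rw [smallestPart, ← coe_min' hne, WithTop.untopD_coe]
  exact Multiset.mem_toFinset.1 (min'_mem _ _)

theorem smallestPart_le {π : n.Partition} {i : ℕ} (h : i ∈ π.parts) : smallestPart π ≤ i := by
  have hi := Multiset.mem_toFinset.2 h
  rw [smallestPart, ← coe_min' ⟨i, hi⟩, WithTop.untopD_coe]
  exact min'_le _ _ hi

theorem smallestPart_eq_iff {π : n.Partition} {s : ℕ} (hs : s ≠ 0) :
    smallestPart π = s ↔ s ∈ π.parts ∧ ∀ i ∈ π.parts, s ≤ i := by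
  constructor
  · rintro rfl
    refine ⟨smallestPart_mem fun h => hs ?_, fun i => smallestPart_le⟩
    simp [smallestPart, h]
  · rintro ⟨hmem, hle⟩
    refine (smallestPart_le hmem).antisymm (hle _ (smallestPart_mem ?_))
    exact ne_of_mem_of_not_mem' hmem (Multiset.notMem_zero s)

theorem smallestPart_le_size (π : n.Partition) : smallestPart π ≤ n := by
  by_cases hπ : π.parts = 0
  · simp [smallestPart, hπ]
  · exact π.le_of_mem_parts (smallestPart_mem hπ)

theorem smallestCount_eq_zero {π : n.Partition} (h : smallestPart π = 0) :
    smallestCount π = 0 := by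
  rw [smallestCount, h, Multiset.count_eq_zero]
  exact fun h0 => (π.parts_pos h0).ne rfl

section SumSmallestCount

variable {R : Type*} [CommRing R] {P : n.Partition → Prop} [DecidablePred P] {U : ℕ → Finset ℕ}

theorem coeff_countGenFun_eq_sum_smallestCount (hU : ∀ s, ∀ i ∈ U s, s < i)
    (hP : ∀ π : n.Partition, P π ↔ ∀ i ∈ π.parts, smallestPart π < i → i ∈ U (smallestPart π))
    {s : ℕ} (hs : s ≠ 0) :
    coeff n (countGenFun R s (U s)) =
      ∑ π : n.Partition with P π ∧ smallestPart π = s, (smallestCount π : R) := by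
  have hcount (π : n.Partition) (hπ : P π ∧ smallestPart π = s) :
      (smallestCount π : R) = π.parts.count s := by rw [smallestCount, hπ.2]
  rw [sum_congr rfl fun π hπ => hcount π (mem_filter.1 hπ).2, countGenFun, coeff_mk]
  refine (sum_subset (fun π hπ => ?_) fun π hπ hπ' => ?_).symm
  · obtain ⟨hPπ, hsπ⟩ := (mem_filter.1 hπ).2
    rw [hP, hsπ] at hPπ
    refine mem_filter.2 ⟨mem_univ π, fun i hi => mem_insert.2 ?_⟩
    exact (((smallestPart_eq_iff hs).1 hsπ).2 i hi).eq_or_lt.imp Eq.symm (hPπ i hi)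
  · have hparts := (mem_filter.1 hπ).2
    rw [Multiset.count_eq_zero_of_notMem, Nat.cast_zero]
    refine fun hmem => hπ' (mem_filter.2 ⟨mem_univ π, ?_⟩)
    have hsπ : smallestPart π = s := (smallestPart_eq_iff hs).2 ⟨hmem, fun i hi =>
      (mem_insert.1 (hparts i hi)).elim (fun h => h.ge) fun h => (hU s i h).le⟩
    rw [hP, hsπ]
    exact ⟨fun i hi hlt => (mem_insert.1 (hparts i hi)).resolve_left hlt.ne', rfl⟩

theorem sum_smallestCount_mul (hU : ∀ s, ∀ i ∈ U s, s < i)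
    (hP : ∀ π : n.Partition, P π ↔ ∀ i ∈ π.parts, smallestPart π < i → i ∈ U (smallestPart π))
    {L : ℕ} (hL : n ≤ L) (g : ℕ → R) :
    ∑ π : n.Partition with P π, (smallestCount π : R) * g (smallestPart π) =
      ∑ k ∈ range L, coeff n (countGenFun R (k + 1) (U (k + 1))) * g (k + 1) := by
  have hmaps : ∀ π ∈ ({π | P π} : Finset n.Partition), smallestPart π ∈ range (L + 1) :=
    fun π _ => mem_range.2 (Nat.lt_succ_of_le ((smallestPart_le_size π).trans hL))
  rw [← sum_fiberwise_of_maps_to hmaps, sum_range_succ', add_eq_left.2 (sum_eq_zero fun π hπ => ?_)]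
  · refine sum_congr rfl fun k _ => ?_
    rw [coeff_countGenFun_eq_sum_smallestCount hU hP k.succ_ne_zero, filter_filter, sum_mul]
    exact sum_congr rfl fun π hπ => by rw [(mem_filter.1 hπ).2.2]
  · rw [smallestCount_eq_zero (mem_filter.1 hπ).2, Nat.cast_zero, zero_mul]

end SumSmallestCount

theorem card_isTriangular (l : ℕ) :
    #{δ : n.Partition | IsTriangular l δ} = if n = l.choose 2 then 1 else 0 := by
  have hsum : (Ico 1 l).val.sum = l.choose 2 := by
    rw [sum_val, Nat.choose_two_right, ← sum_range_id, range_eq_Ico]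
    cases l with
    | zero => rfl
    | succ l => rw [sum_eq_sum_Ico_succ_bot l.succ_pos, zero_add]; rfl
  split_ifs with h
  · refine card_eq_one.2 ⟨⟨(Ico 1 l).val, fun hi => ?_, hsum.trans h.symm⟩, ?_⟩
    · exact (mem_Ico.1 (mem_def.2 hi)).1
    ext δ
    rw [mem_filter_univ, mem_singleton, Nat.Partition.ext_iff, IsTriangular]
  · refine card_eq_zero.2 (filter_eq_empty_iff.2 fun δ _ hδ => h ?_)
    rw [← hsum, ← hδ, δ.parts_sum]

/-- The parts greater than `s` that a partition of size at most `L` with smallest part `s` and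
without odd parts greater than `2 s` may have. The even parts are allowed up to `2 L`, so that
the factors `1 - q ^ i` of the even parts greater than `2 s` complete `(q²; q²)_s` to
`(q²; q²)_L`. -/
def oddRestricted (L s : ℕ) : Finset ℕ :=
  Ioc s (2 * s) ∪ (Ioc s L).image (2 * ·)

theorem mem_oddRestricted {L s i : ℕ} :
    i ∈ oddRestricted L s ↔ s < i ∧ i ≤ 2 * s ∨ ∃ j, (s < j ∧ j ≤ L) ∧ 2 * j = i := by
  simp only [oddRestricted, mem_union, mem_Ioc, mem_image]

theorem lt_of_mem_oddRestricted {L s i : ℕ} (h : i ∈ oddRestricted L s) : s < i := by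
  rw [mem_oddRestricted] at h
  omega

theorem prod_oddRestricted {M : Type*} [CommMonoid M] (L s : ℕ) (f : ℕ → M) :
    ∏ i ∈ oddRestricted L s, f i = (∏ i ∈ Ioc s (2 * s), f i) * ∏ i ∈ Ioc s L, f (2 * i) := by
  rw [oddRestricted, prod_union, prod_image fun i _ j _ h => by simpa using h]
  refine disjoint_left.2 fun i hi hi' => ?_
  obtain ⟨j, hj, rfl⟩ := mem_image.1 hi'
  rw [mem_Ioc] at hi hj
  omega

theorem noLargeOdd_iff {L : ℕ} (hL : n ≤ L) (π : n.Partition) :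
    NoLargeOdd π ↔
      ∀ i ∈ π.parts, smallestPart π < i → i ∈ oddRestricted L (smallestPart π) := by
  refine forall₂_congr fun i hi => ?_
  have hin : i ≤ n := π.le_of_mem_parts hi
  have hsi : smallestPart π ≤ i := smallestPart_le hi
  rw [mem_oddRestricted]
  constructor
  · intro hodd hlt
    obtain ⟨j, rfl | rfl⟩ := Nat.even_or_odd' i
    · by_cases hj : j ≤ smallestPart π
      · exact Or.inl ⟨hlt, by omega⟩
      · exact Or.inr ⟨j, by omega, rfl⟩
    · exact Or.inl ⟨hlt, hodd (odd_two_mul_add_one j)⟩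
  · rintro h ⟨j, rfl⟩
    by_contra! hlarge
    obtain ⟨-, hle⟩ | ⟨k, -, hk⟩ := h (by omega) <;> omega

variable (R : Type*) [CommRing R]

/-- The generating function of the smallest parts function, whose coefficients are `spt n` for
`n ≤ L` only: smallest parts and other parts are bounded by `L`. -/
noncomputable def sptGenFun (L : ℕ) : R⟦X⟧ :=
  ∑ k ∈ range L, countGenFun R (k + 1) (Ioc (k + 1) L)

/-- The generating function of the differences `sptO`, whose coefficients are `sptO n` for `n ≤ L`
only: smallest parts and even parts are bounded by `L` and `2 L`. The factor `1 - q ^ C(s, 2)`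
accounts for the triangular partitions `δ_s`. -/
noncomputable def sptOGenFun (L : ℕ) : R⟦X⟧ :=
  ∑ k ∈ range L, countGenFun R (k + 1) (oddRestricted L (k + 1)) * (1 - X ^ (k + 1).choose 2)

variable {R}

theorem coeff_sptGenFun {L : ℕ} (hL : n ≤ L) : coeff n (sptGenFun R L) = spt n := by
  have hP (π : n.Partition) :
      True ↔ ∀ i ∈ π.parts, smallestPart π < i → i ∈ Ioc (smallestPart π) L :=
    iff_of_true trivial fun i hi hlt => mem_Ioc.2 ⟨hlt, (π.le_of_mem_parts hi).trans hL⟩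
  have h := sum_smallestCount_mul (R := R) (fun s i hi => (mem_Ioc.1 hi).1) hP hL 1
  simpa [spt, sptGenFun] using h.symm

theorem sptOPlus_eq_coeff {L : ℕ} (hL : n ≤ L) :
    (sptOPlus n : R) =
      coeff n (∑ k ∈ range L, countGenFun R (k + 1) (oddRestricted L (k + 1))) := by
  have h := sum_smallestCount_mul (R := R) (fun s i => lt_of_mem_oddRestricted)
    (noLargeOdd_iff hL) hL 1
  simpa [sptOPlus] using h

theorem sptOMinus_eq_coeff {L : ℕ} (hL : n ≤ L) :
    (sptOMinus n : R) = coeff n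
      (∑ k ∈ range L,
        countGenFun R (k + 1) (oddRestricted L (k + 1)) * X ^ (k + 1).choose 2) := by
  simp only [map_sum, coeff_mul, coeff_X_pow]
  rw [sum_comm, sptOMinus, Nat.cast_sum]
  refine sum_congr rfl fun ab hab => ?_
  have hle : ab.1 ≤ L := le_self_add.trans ((mem_antidiagonal.1 hab).trans_le hL)
  rw [← sum_smallestCount_mul (fun s i => lt_of_mem_oddRestricted) (noLargeOdd_iff hle) hle
    fun s => if ab.2 = s.choose 2 then 1 else 0, Nat.cast_sum,
    sum_finset_product _ {π | NoLargeOdd π} (fun π => {δ | IsTriangular (smallestPart π) δ})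
      (by simp)]
  refine sum_congr rfl fun π _ => ?_
  dsimp only
  rw [sum_const, card_isTriangular, nsmul_eq_mul, Nat.cast_ite, Nat.cast_one, Nat.cast_zero,
    mul_comm]

theorem coeff_sptOGenFun {L : ℕ} (hL : n ≤ L) : coeff n (sptOGenFun R L) = sptO n := by
  rw [sptO, Int.cast_sub, Int.cast_natCast, Int.cast_natCast, sptOPlus_eq_coeff hL,
    sptOMinus_eq_coeff hL, ← map_sub, ← sum_sub_distrib]
  simp only [sptOGenFun, mul_one_sub]

end SmallestPart

open PowerSeries WithZero LaurentSeries

section Transfer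

variable {R : Type*} [CommRing R] {ψ : R⟦X⟧ →+* K}

theorem map_countGenFun_Ioc_mul (hX : ¬IsOfFinOrder (ψ X)) {L n : ℕ} (hn : n < L) :
    ψ (countGenFun R (n + 1) (Ioc (n + 1) L)) * qFactorial (ψ X) L =
      ψ X ^ (n + 1) * qFactorial (ψ X) n ^ 2 / qFactorial (ψ X) (n + 1) := by
  have hmul := congrArg ψ
    (countGenFun_mul (R := R) n.add_one_ne_zero (U := Ioc (n + 1) L) (by simp) (by simp))
  simp only [map_mul, map_pow, map_sub, map_one, map_prod] at hmul
  rw [eq_div_iff (qFactorial_ne_zero hX _),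
    ← qFactorial_mul_prod_Ioc (ψ X) (Order.add_one_le_of_lt hn), qFactorial_succ]
  linear_combination qFactorial (ψ X) n ^ 2 * hmul

theorem map_countGenFun_oddRestricted_mul (hX : ¬IsOfFinOrder (ψ X)) {L n : ℕ} (hn : n < L) :
    ψ (countGenFun R (n + 1) (oddRestricted L (n + 1))) * qFactorial (ψ X ^ 2) L =
      ψ X ^ (n + 1) * qFactorial (ψ X) n ^ 2 * slaterBeta (ψ X) (n + 1) := by
  have hmul := congrArg ψ (countGenFun_mul (R := R) n.add_one_ne_zero (U := oddRestricted L (n + 1))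
    (fun h => (lt_of_mem_oddRestricted h).not_ge (Nat.zero_le _))
    (fun h => (lt_of_mem_oddRestricted h).false))
  rw [prod_oddRestricted] at hmul
  simp only [map_mul, map_pow, map_sub, map_one, map_prod, pow_mul] at hmul
  have hhalf := qFactorial_mul_prod_Ioc (ψ X) (Nat.le_mul_of_pos_left (n + 1) two_pos)
  rw [slaterBeta, mul_div_assoc', eq_div_iff (mul_ne_zero (qFactorial_ne_zero hX _)
    (qFactorial_ne_zero hX _)), ← hhalf,
    ← qFactorial_mul_prod_Ioc (ψ X ^ 2) (Order.add_one_le_of_lt hn), qFactorial_succ (ψ X)]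
  linear_combination qFactorial (ψ X) n ^ 2 * qFactorial (ψ X ^ 2) (n + 1) * hmul

theorem map_sptOGenFun_mul (hX : ¬IsOfFinOrder (ψ X)) (L : ℕ) :
    ψ (sptOGenFun R L) * qFactorial (ψ X ^ 2) L = ∑ n ∈ range L, ψ X ^ (n + 1) *
      qFactorial (ψ X) n ^ 2 * ((1 - ψ X ^ (n + 1).choose 2) * slaterBeta (ψ X) (n + 1)) := by
  rw [sptOGenFun, map_sum, sum_mul]
  refine sum_congr rfl fun n hn => ?_
  rw [map_mul, map_sub, map_one, map_pow]
  linear_combination (1 - ψ X ^ (n + 1).choose 2) *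
    map_countGenFun_oddRestricted_mul hX (mem_range.1 hn)

theorem map_sptGenFun_mul (hX : ¬IsOfFinOrder (ψ X)) (L : ℕ) :
    ψ (sptGenFun R L) * qFactorial (ψ X) L = ∑ n ∈ range L, ψ X ^ (n + 1) *
      qFactorial (ψ X) n ^ 2 * (1 / qFactorial (ψ X) (n + 1)) := by
  rw [sptGenFun, map_sum, sum_mul]
  refine sum_congr rfl fun n hn => ?_
  rw [map_countGenFun_Ioc_mul hX (mem_range.1 hn), mul_one_div]

theorem valuation_map_sptOGenFun_sub_le {Γ₀ : Type*} [LinearOrderedCommGroupWithZero Γ₀]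
    {v : Valuation K Γ₀} (hX0 : ψ X ≠ 0) (hX : v (ψ X) < 1) (L : ℕ) :
    v (ψ (2 * (sptOGenFun R L - expand 2 two_ne_zero (sptGenFun R L)))) ≤ v (ψ X) ^ (L + 1) := by
  have hord : ¬IsOfFinOrder (ψ X) := not_isOfFinOrder_of_valuation_lt_one hX
  have hX2 : v (ψ X ^ 2) < 1 := by
    rw [map_pow]
    exact pow_lt_one₀ zero_le hX two_ne_zero
  have hexpand : ψ.comp (expand 2 two_ne_zero).toRingHom X = ψ X ^ 2 := by simp
  have hO := map_sptOGenFun_mul hord L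
  have hspt := map_sptGenFun_mul (hexpand ▸ not_isOfFinOrder_sq hord) L
  rw [hexpand, RingHom.comp_apply, AlgHom.toRingHom_eq_coe, RingHom.coe_coe] at hspt
  have hbailey := (isBaileyPair_sptAlpha hX0 hord).valuation_sum_sub_sum_le two_ne_zero hX0 hX
    (isBaileyPair_sptAlpha_sq hX0 hord) (sptAlpha_zero _) (valuation_sptAlpha_le_one hX0 hX) L
  convert hbailey using 1
  rw [← mul_one (v (ψ _)), ← valuation_qFactorial hX2 L, ← map_mul, map_mul ψ, map_sub ψ,
    map_ofNat ψ, mul_assoc, sub_mul, hO, hspt, mul_sub, mul_sum, mul_sum]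
  simp only [Nat.add_one_ne_zero, if_false]
  congr 2 <;> exact sum_congr rfl fun n _ => by ring

end Transfer

theorem coeff_sptOGenFun_eq_coeff_expand {L m : ℕ} (hm : m ≤ L) :
    coeff m (sptOGenFun ℚ L) = coeff m (expand 2 two_ne_zero (sptGenFun ℚ L)) := by
  set φ : ℚ⟦X⟧ →+* ℚ⸨X⸩ := HahnSeries.ofPowerSeries ℤ ℚ
  have hφX0 : φ X ≠ 0 := (map_ne_zero_iff φ HahnSeries.ofPowerSeries_injective).2 X_ne_zero
  have hvX (k : ℕ) : Valued.v (φ X) ^ k = exp (-k : ℤ) := by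
    rw [← map_pow]
    exact LaurentSeries.valuation_X_pow ℚ k
  have hφX : Valued.v (φ X) < 1 := by
    rw [← pow_one (Valued.v (φ X)), hvX, ← exp_zero, exp_lt_exp]
    decide
  have hle := valuation_map_sptOGenFun_sub_le hφX0 hφX L
  rw [hvX] at hle
  have hcoeff := (LaurentSeries.intValuation_le_iff_coeff_lt_eq_zero ℚ _).1 hle m
    (Nat.lt_succ_of_le hm)
  rwa [two_mul, map_add, add_self_eq_zero, map_sub, sub_eq_zero] at hcoeff

end SptO

theorem theorem2_general : PowerSeries.mk SptO.sptO =
    PowerSeries.expand 2 two_ne_zero (PowerSeries.mk fun n => (SptO.spt n : ℤ)) := by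
  ext m
  have h := SptO.coeff_sptOGenFun_eq_coeff_expand (le_refl m)
  rw [SptO.coeff_sptOGenFun le_rfl, PowerSeries.coeff_expand] at h
  rw [PowerSeries.coeff_mk, PowerSeries.coeff_expand]
  split_ifs at h ⊢ with hdvd
  · rw [SptO.coeff_sptGenFun (Nat.div_le_self m 2)] at h
    rw [PowerSeries.coeff_mk]
    exact_mod_cast h
  · exact_mod_cast h

theorem theorem2 (n : ℕ) : SptO.sptO (2 * n) = (SptO.spt n : ℤ) := by
  simpa using congrArg (PowerSeries.coeff (2 * n)) theorem2_general
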